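/- Let $m\ge 1$ be an integer and let $f\colon(-1,1)\to\mathbb{R}$ be such that $f$ is $C^m$ on each of the intervals $(-1,0)$ and $(0,1)$, and on each of these two intervals every derivative $f^{(k)}$, $0\le k\le m$, has finite one-sided limits at both endpoints of the interval (the one-sided limits at $0$ from the left and from the right may differ, and $f(0)$ is arbitrary). A Fourier residual network of depth $L\ge 2$ and width $W\ge 1$ is a function $f_L\colon\mathbb{R}\to\mathbb{R}$ given by $f_1(x)=\Re\sum_{k=1}^{W} c_{1,k}e^{i\omega_{1,k}x}$ and $$f_\ell(x)=f_{\ell-1}(x)+\Re\sum_{k=1}^{W} c_{\ell,k}e^{i\omega_{\ell,k}x}+\Re\sum_{k=1}^{W} c'_{\ell,k}e^{i\omega'_{\ell,k}f_{\ell-1}(x)},\qquad \ell=2,\dots,L,$$ with frequencies $\omega_{\ell,k},\omega'_{\ell,k}\in\mathbb{R}$ and coefficients $c_{\ell,k},c'_{\ell,k}\in\mathbb{C}$. Then there are a constant $D$ and depths $L(\varepsilon)$ and widths $W(\varepsilon)$, $\varepsilon>0$ (all depending on $f$ and $m$, with $D$ independent of $\varepsilon$), such that, as $\varepsilon\to 0^+$,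 $$L(\varepsilon)=\mathcal{O}(\log\varepsilon^{-1}),\qquad W(\varepsilon)=\mathcal{O}\bigl(\varepsilon^{-1/(m-1/2)}\bigr),$$ and for every $\varepsilon>0$ there is a Fourier residual network $F$ of depth $L(\varepsilon)$ and width $W(\varepsilon)$, all of whose coefficients satisfy $|c_{\ell,k}|\le D$ and $|c'_{\ell,k}|\le D$, with $$\|f-F\|_{L^2(-1,1)}\le\varepsilon.$$ -/

import Mathlib

open Filter Topology Asymptotics MeasureTheory

noncomputable section

/-- `f` is `C^m` on the open interval `(a, b)`, and all its derivatives of order `0, …, m` have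
finite one-sided limits at both endpoints. Only the values of `f` on `(a, b)` matter. -/
def IsCcl (m : ℕ) (a b : ℝ) (f : ℝ → ℝ) : Prop :=
  ContDiffOn ℝ m f (Set.Ioo a b) ∧
    ∀ k : ℕ, k ≤ m →
      (∃ l : ℝ, Tendsto (iteratedDerivWithin k f (Set.Ioo a b)) (𝓝[>] a) (𝓝 l)) ∧
      (∃ l : ℝ, Tendsto (iteratedDerivWithin k f (Set.Ioo a b)) (𝓝[<] b) (𝓝 l))

/-- The space of functions on `(-1, 1)` that are `C^m` up to the endpoints, from each side, on
`(-1, 0)` and on `(0, 1)`. A function on `(-1, 1)` is represented by any extension of it to `ℝ`;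
its value at `0` is arbitrary. -/
def IsPiecewiseCcl (m : ℕ) (f : ℝ → ℝ) : Prop :=
  IsCcl m (-1) 0 f ∧ IsCcl m 0 1 f

/-- The parameters of a Fourier residual network of depth `L ≥ 2` and width `W ≥ 1`. Layers are
numbered `1, …, L`: the frequencies `ω ℓ k` and amplitudes `c ℓ k` of the branch fed by the
input are used for `1 ≤ ℓ ≤ L`; the frequencies `ω' ℓ k` and amplitudes `c' ℓ k` of the branch
fed by the preceding layer are used for `2 ≤ ℓ ≤ L`. Values at other indices play no role. -/
structure FourierResNet (L W : ℕ) where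
  two_le_depth : 2 ≤ L
  one_le_width : 1 ≤ W
  ω : ℕ → Fin W → ℝ
  c : ℕ → Fin W → ℂ
  ω' : ℕ → Fin W → ℝ
  c' : ℕ → Fin W → ℂ

/-- `Re ∑ₖ cₖ exp(i ωₖ x)`. -/
def fourierBlock {W : ℕ} (ω : Fin W → ℝ) (c : Fin W → ℂ) (x : ℝ) : ℝ :=
  (∑ k, c k * Complex.exp (Complex.I * (ω k : ℂ) * (x : ℂ))).re

namespace FourierResNet

/-- The output `f_ℓ(x)` of layer `ℓ`; the value at the unused index `0` is a dummy. -/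
def layer {L W : ℕ} (N : FourierResNet L W) : ℕ → ℝ → ℝ
  | 0, _ => 0
  | 1, x => fourierBlock (N.ω 1) (N.c 1) x
  | ℓ + 2, x =>
      N.layer (ℓ + 1) x + fourierBlock (N.ω (ℓ + 2)) (N.c (ℓ + 2)) x +
        fourierBlock (N.ω' (ℓ + 2)) (N.c' (ℓ + 2)) (N.layer (ℓ + 1) x)

/-- The function computed by the network: the output of the last layer. -/
def eval {L W : ℕ} (N : FourierResNet L W) (x : ℝ) : ℝ :=
  N.layer L x

/-- All coefficients (amplitudes) of the network have modulus at most `D`. -/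
def CoeffBoundedBy {L W : ℕ} (N : FourierResNet L W) (D : ℝ) : Prop :=
  (∀ ℓ, 1 ≤ ℓ → ℓ ≤ L → ∀ k, ‖N.c ℓ k‖ ≤ D) ∧
    (∀ ℓ, 2 ≤ ℓ → ℓ ≤ L → ∀ k, ‖N.c' ℓ k‖ ≤ D)

end FourierResNet

end

/-! The residual step `s ↦ s + sin s` repels from `0` and attracts to `±π`, so its iterates starting
from `sin x` tend geometrically to `π * sign x`: depth creates the jump. Adding `sin x` once more
gives a value `y` near `±π + sin x`, which still determines `x` and puts the two sides of the jump
on disjoint intervals. On these, `f` is a function of `y` without a jump: one compactly supported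
`C^m` function `H` satisfies `f = y + H(y)` at `y = ±π + sin x`, and the last residual layer
replaces `H` by a trigonometric polynomial.

Two errors remain. By Parseval and Cauchy-Schwarz, the Fourier tail of `H` is uniformly
`O(N^{-(m-1/2)})`, which fixes the width. The iteration error after `n` steps is `O((2/3)^n / |x|)`
and also bounded; since `H` is Lipschitz it reaches the output multiplied by a constant, and in `L²`
it decays exponentially in `n`, so logarithmic depth suffices. The coefficients are those of `H` and
`-i`, hence bounded independently of `ε`. The main lemmas are `pi_sub_sinStep_mul_le`,
`IsPiecewiseCcl.exists_contDiff_separated` and `exists_fourier_partialSum_bound`. -/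

/-! ### Extension across the endpoints -/

/-- A function that is `C^m` up to the endpoints of an interval extends to a `C^m` function on the
line. -/
theorem IsCcl.exists_contDiff_extension {a b : ℝ} (hab : a < b) {m : ℕ} {f : ℝ → ℝ}
    (hf : IsCcl m a b f) : ∃ g : ℝ → ℝ, ContDiff ℝ m g ∧ Set.EqOn f g (Set.Ioo a b) := by
  induction m generalizing f with
  | zero =>
    obtain ⟨hc, hl⟩ := hf
    obtain ⟨⟨la, ha⟩, ⟨lb, hb⟩⟩ := hl 0 le_rfl
    rw [iteratedDerivWithin_zero] at ha hb
    have hcont := continuousOn_Icc_extendFrom_Ioo hc.continuousOn ha hb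
    refine ⟨Set.IccExtend hab.le ((Set.Icc a b).domRestrict (extendFrom (Set.Ioo a b) f)), ?_, ?_⟩
    · simp only [Nat.cast_zero, contDiff_zero]
      exact (continuousOn_iff_continuous_domRestrict.mp hcont).Icc_extend'
    · intro x hx
      rw [Set.IccExtend_of_mem _ _ (Set.Ioo_subset_Icc_self hx)]
      exact (extendFrom_eq (subset_closure hx) (hc.continuousOn x hx)).symm
  | succ m ih =>
    obtain ⟨hc, hl⟩ := hf
    have hs : UniqueDiffOn ℝ (Set.Ioo a b) := isOpen_Ioo.uniqueDiffOn
    have hc' := hc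
    push_cast at hc'
    rw [contDiffOn_succ_iff_derivWithin hs] at hc'
    -- Extend the derivative and integrate the extension from an interior point.
    obtain ⟨g, hg, hfg⟩ := ih (f := derivWithin f (Set.Ioo a b)) ⟨hc'.2.2, fun k hk => by
      rw [← iteratedDerivWithin_succ']
      exact hl (k + 1) (by omega)⟩
    obtain ⟨x₀, hx₀⟩ := Set.nonempty_Ioo.mpr hab
    have hG : ∀ x, HasDerivAt (fun x => f x₀ + ∫ t in x₀..x, g t) (g x) x := fun x =>
      (intervalIntegral.integral_hasDerivAt_right (hg.continuous.intervalIntegrable _ _)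
        (hg.continuous.stronglyMeasurableAtFilter _ _) hg.continuous.continuousAt).const_add _
    refine ⟨fun x => f x₀ + ∫ t in x₀..x, g t, ?_, ?_⟩
    · push_cast
      rw [contDiff_succ_iff_deriv]
      refine ⟨fun x => (hG x).differentiableAt, by simp, ?_⟩
      rwa [show deriv (fun x => f x₀ + ∫ t in x₀..x, g t) = g from funext fun x => (hG x).deriv]
    · have hcv : Convex ℝ (Set.Ioo a b) := convex_Ioo a b
      refine hcv.eqOn_of_fderivWithin_eq (𝕜 := ℝ) hc'.1
        (fun x _ => (hG x).differentiableAt.differentiableWithinAt) hs ?_ hx₀ (by simp)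
      intro x hx
      have h1 := (hc'.1 x hx).hasDerivWithinAt
      rw [hfg hx] at h1
      rw [h1.hasFDerivWithinAt.fderivWithin (hs x hx),
        (hG x).hasDerivWithinAt.hasFDerivWithinAt.fderivWithin (hs x hx)]

/-! ### Fourier tails of compactly supported functions -/

/-- Integration by parts, `m` times, in the Fourier coefficients of a compactly supported `C^m`
function. -/
theorem fourierCoeffOn_iteratedDeriv {a b : ℝ} (hab : a < b) {m : ℕ} {h : ℝ → ℂ}
    (hh : ContDiff ℝ m h) (hsupp : tsupport h ⊆ Set.Ioo a b) (n : ℤ) :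
    fourierCoeffOn hab (iteratedDeriv m h) n =
      (2 * Real.pi * Complex.I * n / (b - a)) ^ m * fourierCoeffOn hab h n := by
  induction m generalizing h with
  | zero => simp
  | succ m ih =>
    push_cast at hh
    have hh' := hh
    rw [contDiff_succ_iff_deriv] at hh'
    have hne : ((b : ℂ) - a) ≠ 0 := by
      rw [← Complex.ofReal_sub]; exact_mod_cast (sub_pos.mpr hab).ne'
    have ha : h a = 0 := image_eq_zero_of_notMem_tsupport fun hmem => (hsupp hmem).1.ne rfl
    have hb : h b = 0 := image_eq_zero_of_notMem_tsupport fun hmem => (hsupp hmem).2.ne rfl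
    have hderiv : fourierCoeffOn hab (deriv h) n =
        (2 * Real.pi * Complex.I * n / (b - a)) * fourierCoeffOn hab h n := by
      -- The integration by parts formula divides by `n`, so the mean is treated apart.
      rcases eq_or_ne n 0 with rfl | hn
      · rw [fourierCoeffOn_eq_integral]
        have : ∫ x in a..b, deriv h x = 0 := by
          rw [intervalIntegral.integral_deriv_eq_sub (fun x _ => hh'.1 x)
            (hh'.2.2.continuous.intervalIntegrable _ _), ha, hb, sub_zero]
        simp [this]
      · rw [fourierCoeffOn_of_hasDerivAt hab hn (fun x _ => (hh'.1 x).hasDerivAt)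
          (hh'.2.2.continuous.intervalIntegrable _ _), ha, hb]
        have hn' : (n : ℂ) ≠ 0 := by exact_mod_cast hn
        have hpi : (Real.pi : ℂ) ≠ 0 := by exact_mod_cast Real.pi_ne_zero
        field_simp [Complex.I_ne_zero]
        ring
    rw [iteratedDeriv_succ', ih hh'.2.2 (tsupport_deriv_subset.trans hsupp), hderiv]
    ring

theorem sum_inv_sq_le_of_injOn_natAbs {N : ℕ} (hN : 1 ≤ N) (s : Finset ℤ)
    (hs : ∀ k ∈ s, N < k.natAbs) (hinj : Set.InjOn Int.natAbs (s : Set ℤ)) :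
    ∑ k ∈ s, ((k : ℝ) ^ 2)⁻¹ ≤ (N : ℝ)⁻¹ := by
  have h1 : ∑ k ∈ s, ((k : ℝ) ^ 2)⁻¹ = ∑ n ∈ s.image Int.natAbs, ((n : ℝ) ^ 2)⁻¹ := by
    rw [Finset.sum_image hinj]
    refine Finset.sum_congr rfl fun k _ => ?_
    rw [Nat.cast_natAbs, Int.cast_abs, sq_abs]
  obtain ⟨M, hM⟩ := (s.image Int.natAbs).exists_nat_subset_range
  rw [h1]
  calc ∑ n ∈ s.image Int.natAbs, ((n : ℝ) ^ 2)⁻¹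
      ≤ ∑ n ∈ Finset.Ioc N (max N M), ((n : ℝ) ^ 2)⁻¹ := by
        refine Finset.sum_le_sum_of_subset_of_nonneg ?_ fun _ _ _ => by positivity
        intro n hn
        have h2 := Finset.mem_range.mp (hM hn)
        obtain ⟨k, hk, rfl⟩ := Finset.mem_image.mp hn
        have := hs k hk
        simp only [Finset.mem_Ioc]
        omega
    _ ≤ (N : ℝ)⁻¹ - ((max N M : ℕ) : ℝ)⁻¹ := sum_Ioc_inv_sq_le_sub (by omega) (le_max_left _ _)
    _ ≤ (N : ℝ)⁻¹ := by
        have : (0 : ℝ) ≤ ((max N M : ℕ) : ℝ)⁻¹ := by positivity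
        linarith

/-- On positive and on nonpositive integers separately the absolute value is injective, so each half
costs one telescoping tail. -/
theorem sum_int_inv_sq_le {N : ℕ} (hN : 1 ≤ N) (s : Finset ℤ) (hs : ∀ k ∈ s, N < k.natAbs) :
    ∑ k ∈ s, ((k : ℝ) ^ 2)⁻¹ ≤ 2 * (N : ℝ)⁻¹ := by
  rw [← Finset.sum_filter_add_sum_filter_not s (fun k => 0 < k), two_mul]
  refine add_le_add (sum_inv_sq_le_of_injOn_natAbs hN _ ?_ ?_)
    (sum_inv_sq_le_of_injOn_natAbs hN _ ?_ ?_)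
  · exact fun k hk => hs k (Finset.mem_filter.mp hk).1
  · intro k hk l hl h
    simp only [Finset.coe_filter, Set.mem_ofPred_eq] at hk hl
    omega
  · exact fun k hk => hs k (Finset.mem_filter.mp hk).1
  · intro k hk l hl h
    simp only [Finset.coe_filter, Set.mem_ofPred_eq] at hk hl
    omega

/-- A sequence whose `m`-th power weighted version is square summable has `ℓ¹` tails of order
`N^{-(m - 1/2)}`. -/
theorem sum_norm_le_of_sq_summable {m : ℕ} (hm : 1 ≤ m) {c : ℤ → ℂ} {K : ℝ}
    (hc : ∀ s : Finset ℤ, ∑ k ∈ s, (|(k : ℝ)| ^ m * ‖c k‖) ^ 2 ≤ K ^ 2) (hK : 0 ≤ K)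
    {N : ℕ} (hN : 1 ≤ N) (s : Finset ℤ) (hs : ∀ k ∈ s, N < k.natAbs) :
    ∑ k ∈ s, ‖c k‖ ≤ 2 * K * (N : ℝ) ^ (-((m : ℝ) - 1 / 2)) := by
  have hN0 : (0 : ℝ) < N := by exact_mod_cast hN
  have hk : ∀ k ∈ s, (N : ℝ) ≤ |(k : ℝ)| := fun k hk => by
    rw [← Int.cast_abs, ← Nat.cast_natAbs]; exact_mod_cast (hs k hk).le
  -- Only the tail of `∑ k⁻²` is needed: `|k|^{-2m} ≤ N^{-2(m-1)} k⁻²` when `|k| ≥ N`. The factor 2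
  -- is then rounded up to 4 to give a perfect square.
  have hw : ∑ k ∈ s, ((|(k : ℝ)| ^ m)⁻¹) ^ 2 ≤ (2 * (N : ℝ) ^ (-((m : ℝ) - 1 / 2))) ^ 2 := by
    calc ∑ k ∈ s, ((|(k : ℝ)| ^ m)⁻¹) ^ 2
        ≤ ∑ k ∈ s, ((N : ℝ) ^ (2 * (m - 1)))⁻¹ * ((k : ℝ) ^ 2)⁻¹ := by
          refine Finset.sum_le_sum fun k hks => ?_
          have h1 := hk k hks
          have h2 : 0 < |(k : ℝ)| := hN0.trans_le h1
          rw [← mul_inv, inv_pow, ← pow_mul, ← sq_abs (k : ℝ)]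
          gcongr
          rw [show m * 2 = 2 * (m - 1) + 2 by omega, pow_add]
          gcongr
      _ ≤ ((N : ℝ) ^ (2 * (m - 1)))⁻¹ * (2 * (N : ℝ)⁻¹) := by
          rw [← Finset.mul_sum]
          gcongr
          exact sum_int_inv_sq_le hN s hs
      _ = 2 * (N : ℝ) ^ (-(2 * (m : ℝ) - 1)) := by
          rw [Real.rpow_neg hN0.le, ← Real.rpow_natCast, ← Real.rpow_neg_one (N : ℝ),
            ← Real.rpow_neg hN0.le, ← Real.rpow_neg hN0.le, mul_left_comm,
            ← Real.rpow_add hN0]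
          push_cast [Nat.cast_sub hm]
          ring_nf
      _ ≤ (2 * (N : ℝ) ^ (-((m : ℝ) - 1 / 2))) ^ 2 := by
          rw [mul_pow, ← Real.rpow_natCast _ 2, ← Real.rpow_natCast _ 2, ← Real.rpow_mul hN0.le]
          have : (0 : ℝ) < (N : ℝ) ^ (-(2 * (m : ℝ) - 1)) := Real.rpow_pos_of_pos hN0 _
          rw [show -((m : ℝ) - 1 / 2) * ((2 : ℕ) : ℝ) = -(2 * (m : ℝ) - 1) by push_cast; ring]
          rw [Nat.cast_ofNat, Real.rpow_two]
          linarith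
  calc ∑ k ∈ s, ‖c k‖ = ∑ k ∈ s, (|(k : ℝ)| ^ m)⁻¹ * (|(k : ℝ)| ^ m * ‖c k‖) := by
        refine Finset.sum_congr rfl fun k hks => ?_
        have : |(k : ℝ)| ^ m ≠ 0 := (pow_pos (hN0.trans_le (hk k hks)) m).ne'
        field_simp
    _ ≤ √(∑ k ∈ s, ((|(k : ℝ)| ^ m)⁻¹) ^ 2) * √(∑ k ∈ s, (|(k : ℝ)| ^ m * ‖c k‖) ^ 2) :=
        Real.sum_mul_le_sqrt_mul_sqrt _ _ _
    _ ≤ (2 * (N : ℝ) ^ (-((m : ℝ) - 1 / 2))) * K := by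
        gcongr
        · exact Real.sqrt_le_iff.mpr ⟨by positivity, hw⟩
        · exact Real.sqrt_le_iff.mpr ⟨hK, hc s⟩
    _ = _ := by ring

/-- Uniform approximation of a compactly supported `C^m` function by partial sums of its Fourier
series. -/
theorem exists_fourier_partialSum_bound {a b : ℝ} (hab : a < b) {m : ℕ} (hm : 1 ≤ m)
    {h : ℝ → ℝ} (hh : ContDiff ℝ m h) (hsupp : tsupport h ⊆ Set.Ioo a b) :
    ∃ (c : ℤ → ℂ) (D C : ℝ), (∀ k, ‖c k‖ ≤ D) ∧ 0 < C ∧ ∀ N : ℕ, 1 ≤ N → ∀ y ∈ Set.Ico a b,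
      |h y - (∑ k ∈ Finset.Icc (-(N : ℤ)) N, c k * Complex.exp (Complex.I *
        ((2 * Real.pi / (b - a) * k : ℝ) : ℂ) * (y : ℂ))).re| ≤
          C * (N : ℝ) ^ (-((m : ℝ) - 1 / 2)) := by
  set g : ℝ → ℂ := fun x => (h x : ℂ) with hg
  have hgC : ContDiff ℝ m g := Complex.ofRealCLM.contDiff.comp hh
  have hgs : tsupport g ⊆ Set.Ioo a b :=
    (closure_mono (fun x hx => by simpa [hg] using hx)).trans hsupp
  set T : ℝ := b - a with hT
  have hTpos : 0 < T := sub_pos.mpr hab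
  have : Fact (0 < T) := ⟨hTpos⟩
  set c : ℤ → ℂ := fourierCoeffOn hab g with hc
  set S : ℝ := (b - a)⁻¹ • ∫ x in a..b, ‖iteratedDeriv m g x‖ ^ 2 with hS
  have hcont : Continuous (iteratedDeriv m g) := hgC.continuous_iteratedDeriv m le_rfl
  have hL2 : MemLp (iteratedDeriv m g) 2 (volume.restrict (Set.Ioc a b)) := by
    obtain ⟨B, hB⟩ := isCompact_Icc.exists_bound_of_continuousOn (s := Set.Icc a b)
      hcont.continuousOn
    refine MemLp.of_bound hcont.aestronglyMeasurable B ?_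
    filter_upwards [ae_restrict_mem measurableSet_Ioc] with x hx
    exact hB x (Set.Ioc_subset_Icc_self hx)
  have hsum := hasSum_sq_fourierCoeffOn hab hL2
  have hS0 : 0 ≤ S := hsum.nonneg fun _ => by positivity
  set r : ℝ := (T / (2 * Real.pi)) ^ m with hr
  have hr0 : 0 < r := by have := Real.pi_pos; positivity
  have hsq : ∀ s : Finset ℤ, ∑ k ∈ s, (|(k : ℝ)| ^ m * ‖c k‖) ^ 2 ≤ (r * √S) ^ 2 := by
    intro s
    have h1 : ∀ k : ℤ, (|(k : ℝ)| ^ m * ‖c k‖) ^ 2 =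
        r ^ 2 * ‖fourierCoeffOn hab (iteratedDeriv m g) k‖ ^ 2 := by
      intro k
      rw [fourierCoeffOn_iteratedDeriv hab hgC hgs, norm_mul, norm_pow, norm_div,
        ← Complex.ofReal_sub, Complex.norm_real, Real.norm_of_nonneg (sub_pos.mpr hab).le,
        norm_mul, norm_mul, norm_mul, Complex.norm_I, Complex.norm_real,
        Real.norm_of_nonneg Real.pi_pos.le, Complex.norm_two, Complex.norm_intCast, hr, hT, hc]
      have := Real.pi_pos
      have := sub_pos.mpr hab
      rw [← mul_pow, ← mul_assoc, ← mul_pow]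
      congr 3
      field_simp
    simp_rw [h1]
    rw [← Finset.mul_sum, mul_pow, Real.sq_sqrt hS0]
    gcongr
    exact sum_le_hasSum s (fun _ _ => by positivity) hsum
  have htail := fun (N : ℕ) (hN : 1 ≤ N) =>
    sum_norm_le_of_sq_summable hm hsq (by positivity) hN
  -- Outside `{-1, 0, 1}` the tail bound with `N = 1` applies. Summability makes the Fourier series
  -- converge at every point.
  have hsummable : Summable fun k => ‖c k‖ := by
    rw [← Finset.summable_compl_iff (Finset.Icc (-1 : ℤ) 1)]
    refine summable_of_sum_le (fun _ => norm_nonneg _)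
      (c := 2 * (r * √S) * ((1 : ℕ) : ℝ) ^ (-((m : ℝ) - 1 / 2))) fun u => ?_
    have := htail 1 le_rfl (u.map (Function.Embedding.subtype _)) (by
      intro k hk
      simp only [Finset.mem_map, Function.Embedding.coe_subtype, Subtype.exists] at hk
      obtain ⟨l, hl, -, rfl⟩ := hk
      simp only [Finset.mem_Icc] at hl
      omega)
    simpa using this
  have hper : g a = g (a + T) := by
    have ha : g a = 0 := image_eq_zero_of_notMem_tsupport fun hmem => (hgs hmem).1.ne rfl
    have hb : g b = 0 := image_eq_zero_of_notMem_tsupport fun hmem => (hgs hmem).2.ne rfl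
    rw [hT, add_sub_cancel, ha, hb]
  let G : C(AddCircle T, ℂ) := ⟨AddCircle.liftIco T a g,
    AddCircle.liftIco_continuous hper hgC.continuous.continuousOn⟩
  have hGc : fourierCoeff G = c := by
    ext n
    change fourierCoeff (AddCircle.liftIco T a g) n = _
    rw [fourierCoeff_liftIco_eq, hc, fourierCoeffOn_eq_integral, fourierCoeffOn_eq_integral]
    congr 2 <;> simp [hT]
  refine ⟨c, ∑' k, ‖c k‖, 2 * (r * √S) + 1, fun k => hsummable.le_tsum k fun _ _ => norm_nonneg _,
    by positivity, fun N hN y hy => ?_⟩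
  have hser := has_pointwise_sum_fourier_series_of_summable (f := G)
    (by rw [hGc]; exact hsummable.of_norm) (y : AddCircle T)
  have hGy : G (y : AddCircle T) = g y := by
    change AddCircle.liftIco T a g (y : AddCircle T) = g y
    exact AddCircle.liftIco_coe_apply (by rwa [hT, add_sub_cancel])
  rw [hGc, hGy] at hser
  have hterm : ∀ k : ℤ, c k * Complex.exp (Complex.I *
      ((2 * Real.pi / T * k : ℝ) : ℂ) * (y : ℂ)) = c k • fourier k (y : AddCircle T) := by
    intro k
    rw [fourier_coe_apply, smul_eq_mul]
    congr 2
    push_cast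
    ring
  set F := Finset.Icc (-(N : ℤ)) N with hF
  have hbound : ‖g y - ∑ k ∈ F, c k • fourier k (y : AddCircle T)‖ ≤
      2 * (r * √S) * (N : ℝ) ^ (-((m : ℝ) - 1 / 2)) := by
    have htend := ((hser.sub_const (∑ k ∈ F, c k • fourier k (y : AddCircle T))).norm)
    refine le_of_tendsto htend ?_
    filter_upwards [eventually_ge_atTop F] with s hs
    rw [← Finset.sum_sdiff hs, add_sub_cancel_right]
    refine (norm_sum_le _ _).trans (le_trans (Finset.sum_le_sum fun k _ => ?_) (htail N hN (s \ F) ?_))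
    · rw [norm_smul, fourier_apply, Circle.norm_coe, mul_one]
    · intro k hk
      simp only [hF, Finset.mem_sdiff, Finset.mem_Icc] at hk
      omega
  simp_rw [hterm]
  calc |h y - (∑ k ∈ F, c k • fourier k (y : AddCircle T)).re|
      = |(g y - ∑ k ∈ F, c k • fourier k (y : AddCircle T)).re| := by
        rw [Complex.sub_re]; simp [hg]
    _ ≤ ‖g y - ∑ k ∈ F, c k • fourier k (y : AddCircle T)‖ := Complex.abs_re_le_norm _
    _ ≤ _ := hbound
    _ ≤ _ := by gcongr; linarith

/-! ### Dynamics of the residual step -/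

/-- A single residual step, with repelling fixed point `0` and attracting fixed points `±π`. -/
noncomputable def sinStep (s : ℝ) : ℝ := s + Real.sin s

theorem sinStep_iterate_neg (n : ℕ) (s : ℝ) : sinStep^[n] (-s) = -sinStep^[n] s := by
  induction n generalizing s with
  | zero => rfl
  | succ n ih =>
    rw [Function.iterate_succ_apply, Function.iterate_succ_apply, ← ih]
    congr 1
    rw [sinStep, sinStep, Real.sin_neg]
    ring

/-- The ratio `(π - s) / s` measures both the escape from `0` and the approach to `π`, and each step
contracts it by `2/3`. Up to `π/2`, `sin s ≥ s/2` enlarges the denominator by `3/2`; beyond, `sin s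
≥ (π - s)/2` halves the numerator. -/
theorem pi_sub_sinStep_mul_le {s : ℝ} (h0 : 0 < s) (hpi : s ≤ Real.pi) :
    (Real.pi - sinStep s) * s ≤ 2 / 3 * (Real.pi - s) * sinStep s := by
  have hpi4 : Real.pi ≤ 4 := Real.pi_le_four
  have hpi0 := Real.pi_pos
  have hdiv : 1 / 2 ≤ 2 / Real.pi := by
    rw [div_le_div_iff₀ (by norm_num) hpi0]; linarith
  have hsin : 0 ≤ Real.sin s := Real.sin_nonneg_of_nonneg_of_le_pi h0.le hpi
  unfold sinStep
  rcases le_total s (Real.pi / 2) with h | h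
  · have h1 := Real.mul_le_sin h0.le h
    have h2 : s / 2 ≤ Real.sin s := by nlinarith
    nlinarith [mul_nonneg (sub_nonneg.mpr hpi) (sub_nonneg.mpr h2)]
  · have h1 := Real.mul_le_sin (x := Real.pi - s) (by linarith) (by linarith)
    rw [Real.sin_pi_sub] at h1
    have h2 : (Real.pi - s) / 2 ≤ Real.sin s := by nlinarith
    nlinarith [mul_nonneg (sub_nonneg.mpr hpi) hsin, mul_nonneg h0.le (sub_nonneg.mpr h2),
      mul_nonneg h0.le (sub_nonneg.mpr hpi)]

theorem sinStep_iterate_bounds {s : ℝ} (h0 : 0 < s) (hpi : s ≤ Real.pi) (n : ℕ) :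
    0 < sinStep^[n] s ∧ sinStep^[n] s ≤ Real.pi ∧
      Real.pi - sinStep^[n] s ≤ (2 / 3) ^ n * (Real.pi / s) * sinStep^[n] s := by
  induction n with
  | zero =>
    refine ⟨h0, hpi, ?_⟩
    simp only [Function.iterate_zero, id, pow_zero, one_mul]
    rw [div_mul_cancel₀ _ h0.ne']
    linarith
  | succ n ih =>
    rw [Function.iterate_succ_apply']
    obtain ⟨h1, h2, h3⟩ := ih
    set t := sinStep^[n] s with ht
    have hsin : 0 ≤ Real.sin t := Real.sin_nonneg_of_nonneg_of_le_pi h1.le h2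
    have hpos : 0 < sinStep t := by unfold sinStep; linarith
    refine ⟨hpos, ?_, ?_⟩
    · have := Real.sin_le (x := Real.pi - t) (by linarith)
      rw [Real.sin_pi_sub] at this
      unfold sinStep
      linarith
    · have h4 := pi_sub_sinStep_mul_le h1 h2
      refine le_of_mul_le_mul_right (h4.trans ?_) h1
      calc 2 / 3 * (Real.pi - t) * sinStep t
          ≤ 2 / 3 * ((2 / 3) ^ n * (Real.pi / s) * t) * sinStep t := by gcongr
        _ = _ := by ring

/-- Away from the jump the iterates of `sinStep` approach `π` geometrically. -/
theorem abs_pi_sub_sinStep_iterate_sin_le {x : ℝ} (hx : x ∈ Set.Ioo (0 : ℝ) 1) (n : ℕ) :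
    sinStep^[n] (Real.sin x) ∈ Set.Ioc 0 Real.pi ∧ |Real.pi - sinStep^[n] (Real.sin x)| ≤ 32 ∧
      |Real.pi - sinStep^[n] (Real.sin x)| ≤ 32 * (2 / 3) ^ n / x := by
  have hpi4 : Real.pi ≤ 4 := Real.pi_le_four
  have hpi3 := Real.pi_gt_three
  have hdiv : 1 / 2 ≤ 2 / Real.pi := by
    rw [div_le_div_iff₀ (by norm_num) Real.pi_pos]; linarith
  have h1 := Real.mul_le_sin hx.1.le (by linarith [hx.2])
  have h2 : x / 2 ≤ Real.sin x := by nlinarith [hx.1]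
  have hs0 : 0 < Real.sin x := by linarith [hx.1]
  obtain ⟨h3, h4, h5⟩ := sinStep_iterate_bounds hs0 (by linarith [Real.sin_le_one x]) n
  rw [abs_of_nonneg (by linarith)]
  refine ⟨⟨h3, h4⟩, by linarith, h5.trans ?_⟩
  have hx0 := hx.1
  -- Here 32 is `4 · 2 · 4`, from `π ≤ 4` twice and `sin x ≥ x/2`.
  calc (2 / 3) ^ n * (Real.pi / Real.sin x) * sinStep^[n] (Real.sin x)
      ≤ (2 / 3) ^ n * (4 / (x / 2)) * 4 := by
        gcongr
        linarith
    _ = _ := by field_simp; ring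

/-! ### Realisation as a network -/

theorem fourierBlock_single {W : ℕ} (ω : Fin W → ℝ) (k₀ : Fin W) (hω : ω k₀ = 1) (x : ℝ) :
    fourierBlock ω (Pi.single k₀ (-Complex.I)) x = Real.sin x := by
  unfold fourierBlock
  rw [Finset.sum_eq_single k₀ (fun k _ hk => by simp [hk]) (by simp), hω, Pi.single_eq_same,
    show Complex.I * ((1 : ℝ) : ℂ) * (x : ℂ) = (x : ℂ) * Complex.I by push_cast; ring]
  simp [Complex.exp_ofReal_mul_I_re, Complex.exp_ofReal_mul_I_im]

theorem fourierBlock_zero {W : ℕ} (ω : Fin W → ℝ) (x : ℝ) : fourierBlock ω 0 x = 0 := by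
  simp [fourierBlock]

theorem fourierBlock_symmetric (N : ℕ) (θ : ℝ) (c : ℤ → ℂ) (y : ℝ) :
    fourierBlock (fun k : Fin (2 * N + 1) => θ * ((k : ℤ) - N : ℤ))
      (fun k => c ((k : ℤ) - N)) y =
    (∑ k ∈ Finset.Icc (-(N : ℤ)) N,
      c k * Complex.exp (Complex.I * ((θ * k : ℝ) : ℂ) * (y : ℂ))).re := by
  unfold fourierBlock
  congr 1
  refine Finset.sum_bij (fun k _ => (k : ℤ) - N) ?_ ?_ ?_ ?_
  · intro k _
    have := k.2
    simp only [Finset.mem_Icc]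
    omega
  · intro k _ l _ h
    apply Fin.ext
    omega
  · intro k hk
    simp only [Finset.mem_Icc] at hk
    exact ⟨⟨(k + N).toNat, by omega⟩, Finset.mem_univ _, by simp only; omega⟩
  · intro k _
    rfl

theorem FourierResNet.layer_add_two {L W : ℕ} (F : FourierResNet L W) (ℓ : ℕ) (x : ℝ) :
    F.layer (ℓ + 2) x = F.layer (ℓ + 1) x + fourierBlock (F.ω (ℓ + 2)) (F.c (ℓ + 2)) x +
      fourierBlock (F.ω' (ℓ + 2)) (F.c' (ℓ + 2)) (F.layer (ℓ + 1) x) := rfl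

/-- A network of depth `n + 3` that iterates `sinStep` on `sin x`, adds `sin x`, and then applies a
residual layer given by a trigonometric polynomial of degree `N`. -/
theorem exists_fourierResNet (n N : ℕ) (θ : ℝ) (c : ℤ → ℂ) {D : ℝ} (hD : 1 ≤ D)
    (hc : ∀ k, ‖c k‖ ≤ D) :
    ∃ F : FourierResNet (n + 3) (2 * N + 1), F.CoeffBoundedBy D ∧ ∀ x,
      F.eval x = (sinStep^[n] (Real.sin x) + Real.sin x) +
        (∑ k ∈ Finset.Icc (-(N : ℤ)) N, c k * Complex.exp (Complex.I * ((θ * k : ℝ) : ℂ) *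
          ((sinStep^[n] (Real.sin x) + Real.sin x : ℝ) : ℂ))).re := by
  have hsingle : ∀ k : Fin (2 * N + 1),
      ‖(Pi.single 0 (-Complex.I) : Fin (2 * N + 1) → ℂ) k‖ ≤ D := by
    intro k
    rcases eq_or_ne k 0 with rfl | hk
    · simpa using hD
    · simpa [hk] using zero_le_one.trans hD
  -- Layer 1 outputs `sin x`, the next `n` layers iterate, layer `n + 2` uses only the input branch
  -- to add `sin x`, and layer `n + 3` uses only the other branch, for the polynomial.
  let F : FourierResNet (n + 3) (2 * N + 1) :=
    { two_le_depth := by omega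
      one_le_width := by omega
      ω := fun _ _ => 1
      c := fun ℓ => if ℓ = 1 ∨ ℓ = n + 2 then Pi.single 0 (-Complex.I) else 0
      ω' := fun ℓ => if ℓ = n + 3 then fun k => θ * ((k : ℤ) - N : ℤ) else fun _ => 1
      c' := fun ℓ => if ℓ = n + 3 then fun k => c ((k : ℤ) - N) else
        if ℓ = n + 2 then 0 else Pi.single 0 (-Complex.I) }
  have hω : ∀ ℓ k, F.ω ℓ k = 1 := fun _ _ => rfl
  have hcF : ∀ ℓ, F.c ℓ = if ℓ = 1 ∨ ℓ = n + 2 then Pi.single 0 (-Complex.I) else 0 :=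
    fun _ => rfl
  have hω' : ∀ ℓ, F.ω' ℓ = if ℓ = n + 3 then
    fun k : Fin (2 * N + 1) => θ * ((k : ℤ) - N : ℤ) else fun _ => 1 :=
    fun _ => rfl
  have hcF' : ∀ ℓ, F.c' ℓ = if ℓ = n + 3 then fun k : Fin (2 * N + 1) => c ((k : ℤ) - N) else
    if ℓ = n + 2 then 0 else Pi.single 0 (-Complex.I) := fun _ => rfl
  clear_value F
  have hlayer : ∀ j ≤ n, ∀ x, F.layer (j + 1) x = sinStep^[j] (Real.sin x) := by
    intro j
    induction j with
    | zero =>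
      intro _ x
      rw [FourierResNet.layer, hcF, if_pos (Or.inl rfl), fourierBlock_single _ _ (hω _ _)]
      rfl
    | succ j ih =>
      intro hj x
      rw [FourierResNet.layer_add_two, hcF, hω', hcF', if_neg (by omega), if_neg (by omega),
        if_neg (by omega), if_neg (by omega), fourierBlock_zero, fourierBlock_single _ _ rfl,
        ih (by omega), add_zero, Function.iterate_succ_apply']
      rfl
  have hlayer' : ∀ x, F.layer (n + 2) x = sinStep^[n] (Real.sin x) + Real.sin x := by
    intro x
    rw [FourierResNet.layer_add_two, hcF, hcF', if_pos (Or.inr rfl), if_neg (by omega), if_pos rfl,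
      fourierBlock_zero, fourierBlock_single _ _ (hω _ _), hlayer n le_rfl, add_zero]
  refine ⟨F, ⟨fun ℓ _ _ k => ?_, fun ℓ _ _ k => ?_⟩, fun x => ?_⟩
  · rw [hcF]
    split_ifs
    · exact hsingle k
    · simpa using zero_le_one.trans hD
  · rw [hcF']
    split_ifs
    · exact hc _
    · simpa using zero_le_one.trans hD
    · exact hsingle k
  · change F.layer (n + 1 + 2) x = _
    rw [FourierResNet.layer_add_two, hcF,
      hω', hcF', if_neg (by omega), if_pos rfl, if_pos rfl, fourierBlock_zero, hlayer', add_zero,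
      fourierBlock_symmetric]

/-! ### Separation of the two branches -/

/-- A `C^m` function on `[-1, 1]` factors through `sin` by a `C^m` function supported in
`[-1, 1]`. -/
theorem exists_contDiff_comp_sin {m : ℕ} {q : ℝ → ℝ} (hq : ContDiff ℝ m q) :
    ∃ P : ℝ → ℝ, ContDiff ℝ m P ∧ Function.support P ⊆ Set.Icc (-1) 1 ∧
      ∀ x ∈ Set.Icc (-1 : ℝ) 1, P (Real.sin x) = q x := by
  have hs1 : Real.sin 1 < 1 := Real.sin_lt one_pos
  have hpi := Real.pi_gt_three
  have hs0 : 0 < Real.sin 1 := Real.sin_pos_of_pos_of_lt_pi one_pos (by linarith)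
  -- The cutoff is `1` on the range of `sin` over `[-1, 1]` and supported strictly inside `(-1, 1)`,
  -- away from the singularities of `arcsin`.
  let χ : ContDiffBump (0 : ℝ) := ⟨Real.sin 1, (1 + Real.sin 1) / 2, hs0, by linarith⟩
  have hts : tsupport χ = Metric.closedBall 0 ((1 + Real.sin 1) / 2) := χ.tsupport_eq
  refine ⟨fun u => χ u * q (Real.arcsin u), ?_, ?_, ?_⟩
  · rw [contDiff_iff_contDiffAt]
    intro u
    rcases lt_or_ge |u| 1 with hu | hu
    · rw [abs_lt] at hu
      exact χ.contDiffAt.mul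
        (hq.contDiffAt.comp u (Real.contDiffAt_arcsin hu.1.ne' hu.2.ne))
    · have hmem : u ∉ tsupport χ := by
        rw [hts, Metric.mem_closedBall, dist_zero_right, Real.norm_eq_abs]
        linarith
      refine (contDiffAt_const (c := (0 : ℝ))).congr_of_eventuallyEq ?_
      filter_upwards [notMem_tsupport_iff_eventuallyEq.mp hmem] with v hv
      rw [hv, Pi.zero_apply, zero_mul]
  · intro u hu
    have h1 : u ∈ tsupport χ := subset_tsupport _ fun h => hu (by simp [h])
    rw [hts, Metric.mem_closedBall, dist_zero_right, Real.norm_eq_abs] at h1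
    exact abs_le.mp (by linarith)
  · intro x hx
    have hmono : ∀ a b : ℝ, -1 ≤ a → b ≤ 1 → a ≤ b → Real.sin a ≤ Real.sin b :=
      fun a b ha hb hab => Real.sin_le_sin_of_le_of_le_pi_div_two (by linarith) (by linarith) hab
    have h1 : χ (Real.sin x) = 1 := by
      refine χ.one_of_mem_closedBall ?_
      rw [Metric.mem_closedBall, dist_zero_right, Real.norm_eq_abs, abs_le, ← Real.sin_neg]
      exact ⟨hmono _ _ le_rfl hx.2 hx.1, hmono _ _ hx.1 le_rfl hx.2⟩
    simp only [h1, one_mul]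
    rw [Real.arcsin_sin (by linarith [hx.1]) (by linarith [hx.2])]

/-- The two branches of a piecewise `C^m` function, moved apart by the shifts `±π`, are realised by
one compactly supported `C^m` function. -/
theorem IsPiecewiseCcl.exists_contDiff_separated {m : ℕ} {f : ℝ → ℝ} (hf : IsPiecewiseCcl m f) :
    ∃ H : ℝ → ℝ, ContDiff ℝ m H ∧ tsupport H ⊆ Set.Ioo (-5) 5 ∧
      (∀ x ∈ Set.Ioo (0 : ℝ) 1, H (Real.pi + Real.sin x) = f x - (Real.pi + Real.sin x)) ∧
      ∀ x ∈ Set.Ioo (-1 : ℝ) 0, H (-Real.pi + Real.sin x) = f x - (-Real.pi + Real.sin x) := by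
  have hpi3 := Real.pi_gt_three
  have hpi4 : Real.pi < 4 := Real.pi_lt_four
  obtain ⟨g₁, hg₁, hfg₁⟩ := hf.1.exists_contDiff_extension (by norm_num)
  obtain ⟨g₂, hg₂, hfg₂⟩ := hf.2.exists_contDiff_extension (by norm_num)
  obtain ⟨P₁, hP₁, hs₁, he₁⟩ := exists_contDiff_comp_sin
    (q := fun x => g₁ x - (-Real.pi + Real.sin x))
    (hg₁.sub (contDiff_const.add Real.contDiff_sin))
  obtain ⟨P₂, hP₂, hs₂, he₂⟩ := exists_contDiff_comp_sin
    (q := fun x => g₂ x - (Real.pi + Real.sin x))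
    (hg₂.sub (contDiff_const.add Real.contDiff_sin))
  have hz : ∀ {P : ℝ → ℝ}, Function.support P ⊆ Set.Icc (-1) 1 → ∀ u, 1 < |u| → P u = 0 := by
    intro P hP u hu
    by_contra h
    exact absurd (abs_le.mpr (hP h)) (not_le.mpr hu)
  -- The two bumps lie within distance 1 of `-π` and `π`, so they do not overlap, and `π + 1 < 5`.
  refine ⟨fun y => P₁ (y + Real.pi) + P₂ (y - Real.pi), ?_, ?_, fun x hx => ?_, fun x hx => ?_⟩
  · exact (hP₁.comp (contDiff_id.add contDiff_const)).add
      (hP₂.comp (contDiff_id.sub contDiff_const))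
  · have hcl : tsupport (fun y => P₁ (y + Real.pi) + P₂ (y - Real.pi)) ⊆
        Set.Icc (-Real.pi - 1) (Real.pi + 1) := by
      refine closure_minimal (fun y hy => ?_) isClosed_Icc
      by_contra hmem
      refine hy ?_
      rw [Set.mem_Icc, not_and_or, not_le, not_le] at hmem
      simp only
      rw [hz hs₁, hz hs₂, add_zero] <;> rw [lt_abs] <;> rcases hmem with h | h
      · right; linarith
      · left; linarith
      · right; linarith
      · left; linarith
    exact hcl.trans fun y hy => ⟨by linarith [hy.1], by linarith [hy.2]⟩
  · have := Real.neg_one_le_sin x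
    simp only
    rw [hz hs₁ _ (by rw [lt_abs]; left; linarith), add_sub_cancel_left, zero_add,
      he₂ x ⟨by linarith [hx.1], hx.2.le⟩, hfg₂ hx]
  · have := Real.sin_le_one x
    simp only
    rw [hz hs₂ _ (by rw [lt_abs]; right; linarith), neg_add_cancel_comm, add_zero,
      he₁ x ⟨hx.1.le, by linarith [hx.2]⟩, hfg₁ hx]

/-! ### Error estimates -/

/-- Pointwise error of the network approximation, away from the jump. -/
theorem IsPiecewiseCcl.exists_fourierResNet_pointwise {m : ℕ} (hm : 1 ≤ m) {f : ℝ → ℝ}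
    (hf : IsPiecewiseCcl m f) :
    ∃ D A B : ℝ, 0 < A ∧ 0 < B ∧ ∀ n N : ℕ, 1 ≤ N →
      ∃ F : FourierResNet (n + 3) (2 * N + 1), F.CoeffBoundedBy D ∧
        ∀ x ∈ Set.Ioo (-1 : ℝ) 1, x ≠ 0 →
          |f x - F.eval x| ≤ B * (N : ℝ) ^ (-((m : ℝ) - 1 / 2)) + A ∧
          |f x - F.eval x| ≤
            B * (N : ℝ) ^ (-((m : ℝ) - 1 / 2)) + A * ((2 / 3) ^ n / |x|) := by
  have hpi4 : Real.pi < 4 := Real.pi_lt_four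
  obtain ⟨H, hH, hsupp, hH₁, hH₂⟩ := hf.exists_contDiff_separated
  obtain ⟨c, D, B, hcD, hB, happrox⟩ :=
    exists_fourier_partialSum_bound (by norm_num : (-5 : ℝ) < 5) hm hH hsupp
  have hcs : HasCompactSupport H :=
    HasCompactSupport.of_support_subset_isCompact (isCompact_Icc (a := (-5 : ℝ)) (b := 5))
      ((subset_tsupport H).trans (hsupp.trans Set.Ioo_subset_Icc_self))
  obtain ⟨K, hK⟩ := ContDiff.lipschitzWith_of_hasCompactSupport hcs hH
    (by exact_mod_cast (by omega : m ≠ 0))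
  refine ⟨max D 1, (1 + K) * 32, B, by positivity, hB, fun n N hN => ?_⟩
  obtain ⟨F, hFD, hF⟩ := exists_fourierResNet n N (2 * Real.pi / (5 - -5)) c
    (le_max_right D 1) (fun k => (hcD k).trans (le_max_left _ _))
  have core : ∀ x t d : ℝ, H (t + Real.sin x) = f x - (t + Real.sin x) →
      |sinStep^[n] (Real.sin x)| ≤ Real.pi → |t - sinStep^[n] (Real.sin x)| ≤ d →
      |f x - F.eval x| ≤ B * (N : ℝ) ^ (-((m : ℝ) - 1 / 2)) + (1 + K) * d := by
    intro x t d hHt hs hd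
    rw [hF]
    set s := sinStep^[n] (Real.sin x)
    have hy : s + Real.sin x ∈ Set.Ico (-5 : ℝ) 5 := by
      have h1 := abs_le.mp hs
      have h2 := Real.sin_le_one x
      have h3 := Real.neg_one_le_sin x
      exact ⟨by linarith [h1.1], by linarith [h1.2]⟩
    have hE := happrox N hN _ hy
    set R := (∑ k ∈ Finset.Icc (-(N : ℤ)) N, c k * Complex.exp (Complex.I *
      ((2 * Real.pi / (5 - -5) * k : ℝ) : ℂ) * ((s + Real.sin x : ℝ) : ℂ))).re
    have hL : |H (t + Real.sin x) - H (s + Real.sin x)| ≤ K * |t - s| := by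
      have := hK.dist_le_mul (t + Real.sin x) (s + Real.sin x)
      rwa [Real.dist_eq, Real.dist_eq, add_sub_add_right_eq_sub] at this
    -- The polynomial is compared with `H` at the actual input `s + sin x`, so only `H`, not the
    -- polynomial, needs a Lipschitz bound.
    have hsplit : f x - (s + Real.sin x + R) = (t - s) +
        (H (t + Real.sin x) - H (s + Real.sin x)) + (H (s + Real.sin x) - R) := by
      rw [hHt]; ring
    rw [hsplit]
    have hKd : (1 + K) * |t - s| ≤ (1 + K) * d := by gcongr
    have h3 := abs_add_three (t - s) (H (t + Real.sin x) - H (s + Real.sin x))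
      (H (s + Real.sin x) - R)
    linarith
  refine ⟨F, hFD, fun x hx hx0 => ?_⟩
  have hmain : ∃ t, H (t + Real.sin x) = f x - (t + Real.sin x) ∧
      |sinStep^[n] (Real.sin x)| ≤ Real.pi ∧ |t - sinStep^[n] (Real.sin x)| ≤ 32 ∧
      |t - sinStep^[n] (Real.sin x)| ≤ 32 * (2 / 3) ^ n / |x| := by
    rcases lt_or_gt_of_ne hx0 with hneg | hpos
    · obtain ⟨h1, h2, h3⟩ := abs_pi_sub_sinStep_iterate_sin_le (x := -x)
        ⟨by linarith, by linarith [hx.1]⟩ n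
      rw [Real.sin_neg, sinStep_iterate_neg] at h1 h2 h3
      have habs : |-Real.pi - sinStep^[n] (Real.sin x)| =
          |Real.pi - -sinStep^[n] (Real.sin x)| := by
        rw [← abs_neg]; ring_nf
      refine ⟨-Real.pi, hH₂ x ⟨hx.1, hneg⟩, ?_, habs ▸ h2, ?_⟩
      · rw [abs_le]; exact ⟨by linarith [h1.2], by linarith [h1.1, Real.pi_pos]⟩
      · rw [habs, abs_of_neg hneg]; exact h3
    · obtain ⟨h1, h2, h3⟩ := abs_pi_sub_sinStep_iterate_sin_le (x := x) ⟨hpos, hx.2⟩ n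
      refine ⟨Real.pi, hH₁ x ⟨hpos, hx.2⟩, ?_, h2, ?_⟩
      · rw [abs_of_pos h1.1]; exact h1.2
      · rw [abs_of_pos hpos]; exact h3
  obtain ⟨t, ht, hs, h1, h2⟩ := hmain
  refine ⟨core x t 32 ht hs h1, (core x t _ ht hs h2).trans (le_of_eq ?_)⟩
  ring

/-- Minkowski's inequality for the majorant `E + A · 1_(-r, r)`; the interval lengths `2` and `2r`
enter with `√2` rounded up to `2`. -/
theorem eLpNorm_two_le_of_abs_le {u : ℝ → ℝ} {E A r : ℝ} (hE : 0 ≤ E) (hA : 0 ≤ A) (hr : 0 ≤ r)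
    (h1 : ∀ x ∈ Set.Ioo (-1 : ℝ) 1, x ≠ 0 → |u x| ≤ E + A)
    (h2 : ∀ x ∈ Set.Ioo (-1 : ℝ) 1, x ≠ 0 → r ≤ |x| → |u x| ≤ E) :
    eLpNorm u 2 (volume.restrict (Set.Ioo (-1 : ℝ) 1)) ≤
      ENNReal.ofReal (2 * E + 2 * A * √r) := by
  set μ := volume.restrict (Set.Ioo (-1 : ℝ) 1)
  have hle : ∀ᵐ x ∂μ, ‖u x‖ ≤
      ((fun _ => E) + (Set.Ioo (-r) r).indicator fun _ => A : ℝ → ℝ) x := by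
    filter_upwards [ae_restrict_mem measurableSet_Ioo,
      ae_restrict_of_ae (Measure.ae_ne volume (0 : ℝ))] with x hx hx0
    rw [Real.norm_eq_abs, Pi.add_apply]
    by_cases hmem : x ∈ Set.Ioo (-r) r
    · rw [Set.indicator_of_mem hmem]
      exact h1 x hx hx0
    · rw [Set.indicator_of_notMem hmem, add_zero]
      refine h2 x hx hx0 (not_lt.mp fun h => hmem (abs_lt.mp h))
  have hsqrt : ∀ c : ℝ, 0 ≤ c → (ENNReal.ofReal (2 * c)) ^ (1 / (2 : ENNReal).toReal) ≤
      ENNReal.ofReal (2 * √c) := by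
    intro c hc
    rw [ENNReal.ofReal_rpow_of_nonneg (by positivity) (by simp), ENNReal.toReal_ofNat,
      ← Real.sqrt_eq_rpow]
    refine ENNReal.ofReal_le_ofReal (Real.sqrt_le_iff.mpr ⟨by positivity, ?_⟩)
    rw [mul_pow, Real.sq_sqrt hc]
    linarith
  calc eLpNorm u 2 μ ≤ eLpNorm ((fun _ => E) + (Set.Ioo (-r) r).indicator fun _ => A) 2 μ :=
        eLpNorm_mono_ae_real hle
    _ ≤ eLpNorm (fun _ => E) 2 μ + eLpNorm ((Set.Ioo (-r) r).indicator fun _ => A) 2 μ :=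
        eLpNorm_add_le aestronglyMeasurable_const
          (aestronglyMeasurable_const.indicator measurableSet_Ioo) (by norm_num)
    _ ≤ ENNReal.ofReal (E * (2 * √1)) + ENNReal.ofReal (A * (2 * √r)) := by
        rw [ENNReal.ofReal_mul hE, ENNReal.ofReal_mul hA]
        gcongr
        · rw [eLpNorm_const' _ (by norm_num) (by norm_num), Real.enorm_of_nonneg hE]
          gcongr
          refine le_trans ?_ (hsqrt 1 zero_le_one)
          gcongr
          rw [Measure.restrict_apply_univ, Real.volume_Ioo]
          norm_num
        · rw [eLpNorm_indicator_const measurableSet_Ioo (by norm_num) (by norm_num),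
            Real.enorm_of_nonneg hA]
          gcongr
          refine le_trans ?_ (hsqrt r hr)
          gcongr
          refine (Measure.restrict_apply_le _ _).trans ?_
          rw [Real.volume_Ioo]
          exact ENNReal.ofReal_le_ofReal (by linarith)
    _ = ENNReal.ofReal (2 * E + 2 * A * √r) := by
        rw [← ENNReal.ofReal_add (by positivity) (by positivity), Real.sqrt_one]
        congr 1
        ring

/-- With `3j` iterations and `ρ = (2/3)^j`, cutting at `|x| = ρ²` balances the errors: outside, the
iteration error is at most a multiple of `ρ³ / ρ² = ρ`; inside, a bounded error on a set of length
`2ρ²` also has `L²` norm of order `ρ`. -/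
theorem IsPiecewiseCcl.exists_fourierResNet_eLpNorm {m : ℕ} (hm : 1 ≤ m) {f : ℝ → ℝ}
    (hf : IsPiecewiseCcl m f) :
    ∃ D C : ℝ, 0 < C ∧ ∀ j N : ℕ, 1 ≤ N →
      ∃ F : FourierResNet (3 * j + 3) (2 * N + 1), F.CoeffBoundedBy D ∧
        eLpNorm (fun x : ℝ => f x - F.eval x) 2 (volume.restrict (Set.Ioo (-1 : ℝ) 1)) ≤
          ENNReal.ofReal (C * (N : ℝ) ^ (-((m : ℝ) - 1 / 2)) + C * (2 / 3) ^ j) := by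
  obtain ⟨D, A, B, hA, hB, hF⟩ := hf.exists_fourierResNet_pointwise hm
  refine ⟨D, 2 * B + 4 * A, by positivity, fun j N hN => ?_⟩
  obtain ⟨F, hFD, hFx⟩ := hF (3 * j) N hN
  refine ⟨F, hFD, ?_⟩
  set e := (N : ℝ) ^ (-((m : ℝ) - 1 / 2))
  have he : 0 ≤ e := by positivity
  set ρ : ℝ := (2 / 3) ^ j with hρ
  have hρ0 : 0 < ρ := by positivity
  refine (eLpNorm_two_le_of_abs_le (E := B * e + A * ρ) (A := A) (r := ρ ^ 2) (by positivity)
    hA.le (by positivity) (fun x hx hx0 => ?_) (fun x hx hx0 hr => ?_)).trans ?_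
  · have := (hFx x hx hx0).1
    have : 0 ≤ A * ρ := by positivity
    linarith
  · refine (hFx x hx hx0).2.trans ?_
    gcongr
    rw [div_le_iff₀ (abs_pos.mpr hx0), mul_comm 3 j, pow_mul, ← hρ, pow_succ' ρ 2]
    gcongr
  · refine ENNReal.ofReal_le_ofReal ?_
    rw [Real.sqrt_sq hρ0.le]
    have h1 : 0 ≤ A * e := by positivity
    have h2 : 0 ≤ B * ρ := by positivity
    linarith

/-! ### Choice of depth and width -/

theorem mainTheorem5 (m : ℕ) (hm : 1 ≤ m) (f : ℝ → ℝ) (hf : IsPiecewiseCcl m f) :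
    ∃ (L W : ℝ → ℕ) (D : ℝ),
      (fun ε : ℝ => (L ε : ℝ)) =O[𝓝[>] (0 : ℝ)] (fun ε : ℝ => Real.log ε⁻¹) ∧
      (fun ε : ℝ => (W ε : ℝ)) =O[𝓝[>] (0 : ℝ)]
        (fun ε : ℝ => ε ^ (-(1 / ((m : ℝ) - 1 / 2)))) ∧
      ∀ ε : ℝ, 0 < ε →
        ∃ F : FourierResNet (L ε) (W ε),
          F.CoeffBoundedBy D ∧
          eLpNorm (fun x : ℝ => f x - F.eval x) 2 (volume.restrict (Set.Ioo (-1 : ℝ) 1))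
            ≤ ENNReal.ofReal ε := by
  obtain ⟨D, C, hC, hF⟩ := hf.exists_fourierResNet_eLpNorm hm
  set p : ℝ := (m : ℝ) - 1 / 2 with hp
  have hp0 : 0 < p := by
    have : (1 : ℝ) ≤ m := by exact_mod_cast hm
    linarith
  have hlog : 0 < Real.log (3 / 2) := Real.log_pos (by norm_num)
  have hε1 : ∀ᶠ ε : ℝ in 𝓝[>] 0, 0 < ε ∧ ε < Real.exp (-1) :=
    Ioo_mem_nhdsGT (Real.exp_pos _)
  -- Depth and width are chosen so that each error term is at most `ε/2`. The `+ 1` in the width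
  -- makes `N ≥ 1` immediate.
  refine ⟨fun ε => 3 * ⌈Real.log (2 * C / ε) / Real.log (3 / 2)⌉₊ + 3,
    fun ε => 2 * (⌈(2 * C / ε) ^ (1 / p)⌉₊ + 1) + 1, D, ?_, ?_, fun ε hε => ?_⟩
  · refine IsBigO.of_bound (3 * (|Real.log (2 * C)| + 1) / Real.log (3 / 2) + 6) ?_
    filter_upwards [hε1] with ε ⟨h0, h1⟩
    -- For `ε < e⁻¹` the comparison function is at least `1` and absorbs additive constants.
    have hl : 1 ≤ Real.log ε⁻¹ := by
      rw [Real.log_inv, le_neg, ← Real.log_exp (-1)]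
      exact Real.log_le_log h0 h1.le
    rw [Real.norm_of_nonneg (by positivity), Real.norm_of_nonneg (by linarith)]
    have h2 : Real.log (2 * C / ε) ≤ (|Real.log (2 * C)| + 1) * Real.log ε⁻¹ := by
      rw [div_eq_mul_inv, Real.log_mul (by positivity) (by positivity)]
      nlinarith [le_abs_self (Real.log (2 * C)), abs_nonneg (Real.log (2 * C))]
    have h3 : (⌈Real.log (2 * C / ε) / Real.log (3 / 2)⌉₊ : ℝ) ≤
        (|Real.log (2 * C)| + 1) * Real.log ε⁻¹ / Real.log (3 / 2) + 1 :=
      (Nat.cast_le.mpr (Nat.ceil_mono (by gcongr))).trans (Nat.ceil_lt_add_one (by positivity)).le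
    push_cast
    calc 3 * (⌈Real.log (2 * C / ε) / Real.log (3 / 2)⌉₊ : ℝ) + 3
        ≤ 3 * ((|Real.log (2 * C)| + 1) * Real.log ε⁻¹ / Real.log (3 / 2) + 1) + 3 := by gcongr
      _ = 3 * (|Real.log (2 * C)| + 1) / Real.log (3 / 2) * Real.log ε⁻¹ + 6 := by ring
      _ ≤ _ := by rw [add_mul]; linarith
  · refine IsBigO.of_bound (2 * (2 * C) ^ (1 / p) + 5) ?_
    filter_upwards [hε1] with ε ⟨h0, h1⟩
    have hlt : ε ≤ 1 := h1.le.trans (Real.exp_le_one_iff.mpr (by norm_num))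
    have hge : 1 ≤ ε ^ (-(1 / p)) :=
      Real.one_le_rpow_of_pos_of_le_one_of_nonpos h0 hlt (by simpa using hp0.le)
    rw [Real.norm_of_nonneg (by positivity), Real.norm_of_nonneg (by positivity)]
    have h2 : (2 * C / ε) ^ (1 / p) = (2 * C) ^ (1 / p) * ε ^ (-(1 / p)) := by
      rw [Real.div_rpow (by positivity) h0.le, Real.rpow_neg h0.le, div_eq_mul_inv]
    have h3 := (Nat.ceil_lt_add_one (a := (2 * C / ε) ^ (1 / p)) (by positivity)).le
    rw [h2] at h3 ⊢
    push_cast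
    linarith
  · obtain ⟨F, hFD, hFe⟩ := hF ⌈Real.log (2 * C / ε) / Real.log (3 / 2)⌉₊
      (⌈(2 * C / ε) ^ (1 / p)⌉₊ + 1) (by omega)
    refine ⟨F, hFD, hFe.trans (ENNReal.ofReal_le_ofReal ?_)⟩
    set j := ⌈Real.log (2 * C / ε) / Real.log (3 / 2)⌉₊
    set N := ⌈(2 * C / ε) ^ (1 / p)⌉₊ + 1 with hN
    have hq0 : 0 < 2 * C / ε := by positivity
    have h1 : (N : ℝ) ^ (-p) ≤ (2 * C / ε)⁻¹ := by
      have h2 : (2 * C / ε) ^ (1 / p) ≤ N :=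
        (Nat.le_ceil _).trans (by rw [hN]; push_cast; linarith)
      calc (N : ℝ) ^ (-p) ≤ ((2 * C / ε) ^ (1 / p)) ^ (-p) :=
            Real.rpow_le_rpow_of_nonpos (by positivity) h2 (by linarith)
        _ = (2 * C / ε)⁻¹ := by
            rw [← Real.rpow_mul hq0.le, ← Real.rpow_neg_one]
            congr 1
            field_simp
    have h2 : ((2 : ℝ) / 3) ^ j ≤ (2 * C / ε)⁻¹ := by
      have h3 : Real.log (2 * C / ε) ≤ j * Real.log (3 / 2) :=
        (div_le_iff₀ hlog).mp (Nat.le_ceil _)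
      rw [← Real.log_pow] at h3
      have h4 := (Real.log_le_log_iff hq0 (by positivity)).mp h3
      rw [show (2 : ℝ) / 3 = (3 / 2)⁻¹ by norm_num, inv_pow]
      gcongr
    calc C * (N : ℝ) ^ (-p) + C * (2 / 3) ^ j ≤ C * (2 * C / ε)⁻¹ + C * (2 * C / ε)⁻¹ := by gcongr
      _ = ε := by field_simp; ring
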